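/- Work over $\mathbb{C}$; varieties are reduced separated schemes of finite type over $\mathbb{C}$, not necessarily irreducible. An \emph{affine algebraic Lie groupoid} $\mathcal{G} \rightrightarrows X$ is a groupoid object in the category of complex algebraic varieties such that the varieties $X$ of objects and $\mathcal{G}$ of arrows are smooth and affine, and the source and target maps $\mathsf{s}, \mathsf{t} : \mathcal{G} \to X$ are smooth morphisms. Its \emph{affine quotient} is the affine scheme $$X /\!/ \mathcal{G} := \operatorname{Spec} \mathbb{C}[X]^{\mathcal{G}}, \qquad \mathbb{C}[X]^{\mathcal{G}} := \{a \in \mathbb{C}[X] : \mathsf{s}^*a = \mathsf{t}^*a\}.$$ A \emph{Hartogs Morita morphism} from an affine algebraic Lie groupoid $\mathcal{G} \rightrightarrows X$ to an affine algebraic Lie groupoid $\mathcal{H} \rightrightarrows Y$ is a morphism of groupoid objects $(f, \mu)$, with $f : \mathcal{G} \to \mathcal{H}$ on arrows and $\mu : X \to Y$ on objects, such that $\mu$ is a smooth morphism, the complement of the open subset $\mu(X) \subseteq Y$ has codimension at least two in $Y$ (the empty set having codimension $\infty$), and the induced morphism $$\mathcal{G} \longrightarrow \mu^*\mathcal{H}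 := X \times_{\mu, Y, \mathsf{s}} \mathcal{H} \times_{\mathsf{t}, Y, \mu} X, \qquad g \longmapsto (\mathsf{s}(g), f(g), \mathsf{t}(g)),$$ is an isomorphism. \textbf{Proposition.} Let $(f, \mu) : (\mathcal{G} \rightrightarrows X) \to (\mathcal{H} \rightrightarrows Y)$ be a Hartogs Morita morphism between affine algebraic Lie groupoids. Then the morphism $X /\!/ \mathcal{G} \to Y /\!/ \mathcal{H}$ induced by the algebra homomorphism $\mu^* : \mathbb{C}[Y]^{\mathcal{H}} \to \mathbb{C}[X]^{\mathcal{G}}$ is an isomorphism of affine schemes (over $\mathbb{C}$). -/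

import Mathlib

open CategoryTheory CategoryTheory.Limits AlgebraicGeometry

noncomputable section

universe v u

/-- A groupoid object in a category with pullbacks. Two arrows `a`, `b` (generalized elements)
are composable when `a ≫ s = b ≫ t`; then `m` gives the product `ab`, with source that of `b`
and target that of `a`. -/
structure GroupoidObject (C : Type u) [Category.{v} C] [HasPullbacks C] where
  obj : C
  arr : C
  s : arr ⟶ obj
  t : arr ⟶ obj
  m : pullback s t ⟶ arr
  e : obj ⟶ arr
  i : arr ⟶ arr
  e_s : e ≫ s = 𝟙 obj
  e_t : e ≫ t = 𝟙 obj
  m_s : m ≫ s = pullback.snd s t ≫ s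
  m_t : m ≫ t = pullback.fst s t ≫ t
  i_s : i ≫ s = t
  i_t : i ≫ t = s
  mul_unit : pullback.lift (𝟙 arr) (s ≫ e) (by simp [e_t]) ≫ m = 𝟙 arr
  unit_mul : pullback.lift (t ≫ e) (𝟙 arr) (by simp [e_s]) ≫ m = 𝟙 arr
  mul_inv : pullback.lift (𝟙 arr) i (by simp [i_t]) ≫ m = t ≫ e
  inv_mul : pullback.lift i (𝟙 arr) (by simp [i_s]) ≫ m = s ≫ e
  assoc : ∀ (T : C) (a b c : T ⟶ arr) (hab : a ≫ s = b ≫ t) (hbc : b ≫ s = c ≫ t),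
    pullback.lift (pullback.lift a b hab ≫ m) c
        (by rw [Category.assoc, m_s, pullback.lift_snd_assoc, hbc]) ≫ m =
      pullback.lift a (pullback.lift b c hbc ≫ m)
        (by rw [Category.assoc, m_t, pullback.lift_fst_assoc, hab]) ≫ m

namespace GroupoidObject

variable {C : Type u} [Category.{v} C] [HasPullbacks C]

/-- A morphism `(f, μ)` of groupoid objects. -/
@[ext]
structure Hom (G H : GroupoidObject C) where
  f : G.arr ⟶ H.arr
  μ : G.obj ⟶ H.obj
  f_s : f ≫ H.s = G.s ≫ μ
  f_t : f ≫ H.t = G.t ≫ μ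
  map_unit : G.e ≫ f = μ ≫ H.e
  map_mul : G.m ≫ f = pullback.map G.s G.t H.s H.t f f μ f_s.symm f_t.symm ≫ H.m

/-- The object of arrows `Y ×_{μ,s} G ×_{t,μ} Y` of the pullback groupoid `μ^*G` over `Y`. -/
abbrev pullbackArr (G : GroupoidObject C) {Y : C} (μ : Y ⟶ G.obj) : C :=
  pullback (pullback.snd μ G.s ≫ G.t) μ

/-- The morphism `G ⟶ μ^*H`, `g ↦ (s(g), f(g), t(g))`, induced by `(f, μ) : G ⟶ H`. -/
def Hom.toPullback {G H : GroupoidObject C} (φ : Hom G H) : G.arr ⟶ H.pullbackArr φ.μ :=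
  pullback.lift (pullback.lift G.s φ.f φ.f_s.symm) G.t
    (by rw [pullback.lift_snd_assoc, φ.f_t])

end GroupoidObject

/-- Schemes over the complex numbers. -/
abbrev ComplexScheme : Type 1 := Over (Spec (CommRingCat.of ℂ))

/-- Complex algebraic varieties (not necessarily irreducible): reduced separated schemes of
finite type over the complex numbers. -/
structure IsComplexVariety (X : ComplexScheme) : Prop where
  isReduced : IsReduced X.left
  isSeparated : IsSeparated X.hom
  locallyOfFiniteType : LocallyOfFiniteType X.hom
  quasiCompact : QuasiCompact X.hom

/-- Affine algebraic Lie groupoids: the varieties of objects and arrows are smooth and affine, and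
the source and target maps are smooth morphisms. (By smoothness of source and target, the fibre
products of schemes that occur are again varieties.) -/
structure IsAffineAlgebraicLieGroupoid (G : GroupoidObject ComplexScheme) : Prop where
  obj_variety : IsComplexVariety G.obj
  arr_variety : IsComplexVariety G.arr
  obj_smooth : Smooth G.obj.hom
  arr_smooth : Smooth G.arr.hom
  s_smooth : Smooth G.s.left
  t_smooth : Smooth G.t.left
  obj_affine : IsAffine G.obj.left
  arr_affine : IsAffine G.arr.left

/-- The algebra `ℂ[X]` of regular functions on `X`. -/
def CoordRing (X : ComplexScheme) : Type := Γ(X.left, ⊤)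

instance (X : ComplexScheme) : CommRing (CoordRing X) :=
  inferInstanceAs (CommRing Γ(X.left, ⊤))

/-- The scalars act through the structure morphism `X ⟶ Spec ℂ`. -/
instance (X : ComplexScheme) : Algebra ℂ (CoordRing X) :=
  RingHom.toAlgebra (S := CoordRing X)
    ((Scheme.ΓSpecIso (CommRingCat.of ℂ)).inv ≫ X.hom.appTop).hom

/-- Pullback of functions along a morphism of schemes over the complex numbers. -/
def CoordRing.map {X Y : ComplexScheme} (φ : X ⟶ Y) : CoordRing Y →ₐ[ℂ] CoordRing X :=
  { (φ.left.appTop.hom : Γ(Y.left, ⊤) →+* Γ(X.left, ⊤)) with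
    commutes' := fun c => by
      have h : ((Scheme.ΓSpecIso (CommRingCat.of ℂ)).inv ≫ Y.hom.appTop) ≫ φ.left.appTop =
          (Scheme.ΓSpecIso (CommRingCat.of ℂ)).inv ≫ X.hom.appTop := by
        rw [Category.assoc, ← Scheme.Hom.comp_appTop, Over.w]
      exact congr($h c) }

theorem CoordRing.map_comp_apply {X Y Z : ComplexScheme} (φ : X ⟶ Y) (ψ : Y ⟶ Z)
    (a : CoordRing Z) :
    CoordRing.map (φ ≫ ψ) a = CoordRing.map φ (CoordRing.map ψ a) := by
  have h : (φ ≫ ψ).left.appTop = ψ.left.appTop ≫ φ.left.appTop := by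
    rw [Over.comp_left, Scheme.Hom.comp_appTop]
  exact congr($h a)

/-- The algebra `ℂ[X]^G` of functions `a` on the objects with `s^* a = t^* a`. -/
def invariantFunctions (G : GroupoidObject ComplexScheme) : Subalgebra ℂ (CoordRing G.obj) :=
  AlgHom.equalizer (CoordRing.map G.s) (CoordRing.map G.t)

/-- The homomorphism `ℂ[Y]^H → ℂ[X]^G` given by composition with `μ`, for a morphism
`(f, μ)` from `G` (over `X`) to `H` (over `Y`). -/
def invariantFunctionsMap {G H : GroupoidObject ComplexScheme} (φ : G.Hom H) :
    invariantFunctions H →ₐ[ℂ] invariantFunctions G :=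
  ((CoordRing.map φ.μ).comp (invariantFunctions H).val).codRestrict (invariantFunctions G)
    (fun a => by
      have ha : CoordRing.map H.s a.1 = CoordRing.map H.t a.1 := a.2
      change CoordRing.map G.s (CoordRing.map φ.μ a.1) =
        CoordRing.map G.t (CoordRing.map φ.μ a.1)
      rw [← CoordRing.map_comp_apply, ← CoordRing.map_comp_apply, ← φ.f_s, ← φ.f_t,
        CoordRing.map_comp_apply, CoordRing.map_comp_apply, ha])

/-- The affine quotient `X // G = Spec ℂ[X]^G`, as a scheme over the complex numbers. -/
def affineQuotient (G : GroupoidObject ComplexScheme) : ComplexScheme :=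
  Over.mk (Spec.map (CommRingCat.ofHom (algebraMap ℂ (invariantFunctions G))))

/-- The induced morphism `X // G ⟶ Y // H` of affine quotients. -/
def affineQuotientMap {G H : GroupoidObject ComplexScheme} (φ : G.Hom H) :
    affineQuotient G ⟶ affineQuotient H :=
  Over.homMk (Spec.map (CommRingCat.ofHom (invariantFunctionsMap φ).toRingHom)) (by
    change Spec.map _ ≫ Spec.map _ = Spec.map _
    rw [← Spec.map_comp, ← CommRingCat.ofHom_comp]
    congr 2
    exact (invariantFunctionsMap φ).comp_algebraMap)

/-- The codimension of a closed subset `Z` of a topological space `X`: the infimum, over the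
irreducible closed subsets `T` of `X` contained in `Z`, of the supremum of the lengths of chains
of irreducible closed subsets of `X` starting at `T`. It is `⊤` for empty `Z`. -/
def codimension {X : Type*} [TopologicalSpace X] (Z : Set X) : ℕ∞ :=
  ⨅ (T : TopologicalSpace.IrreducibleCloseds X) (_ : (T : Set X) ⊆ Z), Order.coheight T

/-- A Hartogs Morita morphism `(f, μ)` from `G` to `H`: `μ` is a smooth morphism, the complement
of its image has codimension at least two, and the induced morphism `G ⟶ μ^*H` is an
isomorphism. -/
structure IsHartogsMorita {G H : GroupoidObject ComplexScheme} (φ : G.Hom H) : Prop where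
  smooth : Smooth φ.μ.left
  two_le_codimension : 2 ≤ codimension (Set.range φ.μ.left)ᶜ
  isIso_toPullback : IsIso φ.toPullback

end

/-! Let `A = ℂ[Y]` and `B = ℂ[X]`; `B` is flat over `A`, and `A → B` is injective because `μ` has
dense image and `Y` is reduced. As `G` is the pullback of `H`, the two projections of `X ×_Y X` to
`X` are joined by an arrow lying over a unit, so an invariant `b` satisfies `b ⊗ 1 = 1 ⊗ b` in `B
⊗[A] B` (`tmul_one_eq_of_invariant`). Such a `b` lies in `A`
(`mem_range_algebraMap_of_tmul_one_eq`): at primes in the image of `μ` by faithfully flat descent,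
at the others by Hartogs extension, since there the local ring of the smooth `Y` has depth at least
two (`Algebra.Smooth.exists_isWeaklyRegular_pair`). Finally `b = μ^* a` with `a` invariant under
`H`: `s^* a` and `t^* a` agree after pullback along `f`, which has dense image in a reduced scheme.
-/

/-! ### Regular pairs in local rings of smooth algebras -/

section RegularPairs

open RingTheory.Sequence TensorProduct

theorem isWeaklyRegular_pair_iff {R : Type*} [CommRing R] (u v : R) :
    IsWeaklyRegular R [u, v] ↔
      IsSMulRegular R u ∧ ∀ z : R, u ∣ v * z → u ∣ z := by
  simp only [isWeaklyRegular_cons_iff, IsWeaklyRegular.nil, and_true]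
  refine and_congr_right fun _ => ?_
  rw [isSMulRegular_quotient_iff_mem_of_smul_mem]
  simp [Submodule.mem_smul_pointwise_iff_exists, dvd_def, eq_comm]

/-- In a unique factorization domain, a prime ideal sitting above a nonzero smaller prime ideal
contains a regular sequence of length two. -/
theorem Ideal.exists_isWeaklyRegular_pair_of_lt {P : Type*} [CommRing P] [IsDomain P]
    [UniqueFactorizationMonoid P] {q₁ q₂ : Ideal P} [hq₁ : q₁.IsPrime] (h₁ : q₁ ≠ ⊥)
    (h : q₁ < q₂) : ∃ u ∈ q₂, ∃ v ∈ q₂, IsWeaklyRegular P [u, v] := by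
  obtain ⟨u, hu, hup⟩ := hq₁.exists_mem_prime_of_ne_bot h₁
  obtain ⟨v, hv, hv'⟩ := SetLike.exists_of_lt h
  refine ⟨u, h.le hu, v, hv, (isWeaklyRegular_pair_iff u v).mpr ⟨?_, fun z hz => ?_⟩⟩
  · exact fun x y hxy => mul_left_cancel₀ hup.ne_zero hxy
  · exact (hup.dvd_or_dvd hz).resolve_left fun hd => hv' (q₁.mem_of_dvd hd hu)

/-- A local ring of a smooth algebra over a field at a prime ideal of height at least two contains
a regular sequence of length two in its maximal ideal. -/
theorem Algebra.Smooth.exists_isWeaklyRegular_pair {K A : Type*} [Field K] [CommRing A]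
    [Algebra K A] [Algebra.Smooth K A] {p₀ p₁ p : Ideal A} [p₀.IsPrime] [p₁.IsPrime] [p.IsPrime]
    (h₀ : p₀ < p₁) (h₁ : p₁ < p) :
    ∃ u ∈ IsLocalRing.maximalIdeal (Localization.AtPrime p),
      ∃ v ∈ IsLocalRing.maximalIdeal (Localization.AtPrime p),
        IsWeaklyRegular (Localization.AtPrime p) [u, v] := by
  -- Near `p` the algebra is standard étale over a polynomial ring, which is a UFD; the regular pair
  -- is found there and transported by flatness.
  obtain ⟨f, hf, n, _, _, _⟩ :=
    Algebra.IsSmoothAt.exists_isStandardEtale_mvPolynomial (R := K) (p := p)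
  let P := MvPolynomial (Fin n) K
  let L := Localization.AtPrime p
  have hle : Submonoid.powers f ≤ p.primeCompl := by
    rwa [Submonoid.powers_le]
  let : Algebra (Localization.Away f) L :=
    IsLocalization.localizationAlgebraOfSubmonoidLe _ _ (.powers f) p.primeCompl hle
  have : IsScalarTower A (Localization.Away f) L :=
    IsLocalization.localization_isScalarTower_of_submonoid_le _ _ (.powers f) p.primeCompl hle
  have hloc := IsLocalization.isLocalization_of_submonoid_le (Localization.Away f) L
    (.powers f) p.primeCompl hle
  let : Algebra P L := ((algebraMap (Localization.Away f) L).comp (algebraMap P _)).toAlgebra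
  have : IsScalarTower P (Localization.Away f) L := .of_algebraMap_eq' rfl
  have : Module.Flat (Localization.Away f) L :=
    IsLocalization.flat L (p.primeCompl.map (algebraMap A (Localization.Away f)))
  have : Module.Flat P L := Module.Flat.trans P (Localization.Away f) L
  have : Algebra.QuasiFinite P L :=
    Algebra.QuasiFinite.of_isLocalization (S := Localization.Away f)
      (p.primeCompl.map (algebraMap A (Localization.Away f)))
  let e := IsLocalization.AtPrime.orderIsoOfPrime L p
  let Q₀ := e.symm ⟨p₀, ‹_›, (h₀.trans h₁).le⟩
  let Q₁ := e.symm ⟨p₁, ‹_›, h₁.le⟩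
  let Q₂ := e.symm ⟨p, ‹_›, le_rfl⟩
  have hQ₀ : Q₀.1 < Q₁.1 := e.symm.strictMono (Subtype.mk_lt_mk.mpr h₀)
  have hQ₁ : Q₁.1 < Q₂.1 := e.symm.strictMono (Subtype.mk_lt_mk.mpr h₁)
  have := Q₀.2
  have := Q₁.2
  have := Q₂.2
  -- Quasi-finiteness forbids strict inclusions between primes in one fibre, so the chain stays
  -- strict in `P`.
  have key {I J : Ideal L} [I.IsPrime] [J.IsPrime] (hIJ : I < J) : I.under P < J.under P :=
    lt_of_le_of_ne (Ideal.comap_mono hIJ.le)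
      fun h => hIJ.ne (Algebra.QuasiFinite.eq_of_le_of_under_eq I J hIJ.le h)
  obtain ⟨u, hu, v, hv, huv⟩ := Ideal.exists_isWeaklyRegular_pair_of_lt
    (bot_le.trans_lt (key hQ₀)).ne' (key hQ₁)
  have hmax : Q₂.1 ≤ IsLocalRing.maximalIdeal L := IsLocalRing.le_maximalIdeal Q₂.2.ne_top
  exact ⟨_, hmax hu, _, hmax hv, huv.of_flat (S := L)⟩

end RegularPairs

/-! ### Descent along a flat cover of an open subset -/

section Descent

open RingTheory.Sequence TensorProduct

variable {A B : Type*} [CommRing A] [CommRing B] [Algebra A B]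

/-- Elements of a flat algebra which multiply a regular pair into the base ring lie in the base
ring. -/
theorem RingTheory.Sequence.IsWeaklyRegular.mem_range_algebraMap [Module.Flat A B]
    (hinj : Function.Injective (algebraMap A B)) {u v : A} (huv : IsWeaklyRegular A [u, v]) {x : B}
    (hu : u • x ∈ LinearMap.range (Algebra.linearMap A B))
    (hv : v • x ∈ LinearMap.range (Algebra.linearMap A B)) :
    x ∈ LinearMap.range (Algebra.linearMap A B) := by
  obtain ⟨hreg, hdvd⟩ := (isWeaklyRegular_pair_iff u v).mp huv
  obtain ⟨y, hy⟩ := hu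
  obtain ⟨z, hz⟩ := hv
  -- With `u x = y` and `v x = z`, both sides are `u v x`; regularity then gives `y = u w`, and
  -- cancelling `u` gives `x = w`.
  have hyz : u * z = v * y := hinj <| by
    simp only [Algebra.linearMap_apply] at hy hz
    simp only [map_mul, hy, hz, Algebra.smul_def]
    ring
  obtain ⟨w, rfl⟩ := hdvd y ⟨z, hyz.symm⟩
  refine ⟨w, hreg.of_flat ?_⟩
  simpa [Algebra.smul_def] using hy

theorem exists_notMem_smul_mem_range_of_localization (p : Ideal A) [p.IsPrime] {c : B}
    (hc : (1 : Localization.AtPrime p) ⊗ₜ[A] c ∈ LinearMap.range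
      (Algebra.linearMap (Localization.AtPrime p) (Localization.AtPrime p ⊗[A] B))) :
    ∃ s ∉ p, s • c ∈ LinearMap.range (Algebra.linearMap A B) := by
  obtain ⟨l, hl⟩ := hc
  obtain ⟨z, s, rfl⟩ := IsLocalization.exists_mk'_eq p.primeCompl l
  have h : TensorProduct.mk A (Localization.AtPrime p) B 1 (s.1 • c) =
      TensorProduct.mk A (Localization.AtPrime p) B 1 (algebraMap A B z) := by
    have := congr((s.1 : A) • $hl)
    rw [Algebra.linearMap_apply, Algebra.TensorProduct.algebraMap_apply, smul_tmul',
      Algebra.algebraMap_self_apply, Algebra.smul_def, IsLocalization.mk'_spec'] at this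
    simp only [mk_apply, tmul_smul, ← this]
    rw [Algebra.algebraMap_eq_smul_one, smul_tmul, Algebra.algebraMap_eq_smul_one]
  obtain ⟨t, ht⟩ := (IsLocalizedModule.eq_iff_exists p.primeCompl _).mp h
  refine ⟨t.1 * s.1, (t * s).2, t.1 * z, ?_⟩
  rw [Algebra.linearMap_apply, map_mul, ← Algebra.smul_def, mul_smul]
  exact ht.symm

/-- The point `q` makes the closed fibre nonempty: if the maximal ideal generated everything, the
local map to the local ring at `q` would send `1` into its maximal ideal. -/
theorem faithfullyFlat_localization_tensorProduct [Module.Flat A B] (q : PrimeSpectrum B)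
    (p : Ideal A) [p.IsPrime] (hq : q.asIdeal.comap (algebraMap A B) = p) :
    Module.FaithfullyFlat (Localization.AtPrime p) (Localization.AtPrime p ⊗[A] B) where
  submodule_ne_top m hm htop := by
    obtain rfl := IsLocalRing.eq_maximalIdeal hm
    let g : Localization.AtPrime p →ₐ[A] Localization.AtPrime q.asIdeal :=
      IsLocalization.liftAlgHom (M := p.primeCompl)
        (f := Algebra.ofId A (Localization.AtPrime q.asIdeal)) fun y => by
          have hy : algebraMap A B y ∈ q.asIdeal.primeCompl := fun h => y.2 (hq ▸ h)
          have := IsLocalization.map_units (Localization.AtPrime q.asIdeal) ⟨_, hy⟩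
          rwa [← IsScalarTower.algebraMap_apply] at this
    let φ : Localization.AtPrime p ⊗[A] B →ₐ[A] Localization.AtPrime q.asIdeal :=
      Algebra.TensorProduct.lift g (IsScalarTower.toAlgHom A B _) fun _ _ => .all _ _
    have h1 : (1 : Localization.AtPrime p ⊗[A] B) ∈
        IsLocalRing.maximalIdeal (Localization.AtPrime p) •
          (⊤ : Submodule (Localization.AtPrime p) (Localization.AtPrime p ⊗[A] B)) :=
      by rw [htop]; exact Submodule.mem_top
    suffices h : ∀ x ∈ IsLocalRing.maximalIdeal (Localization.AtPrime p) •
        (⊤ : Submodule (Localization.AtPrime p) (Localization.AtPrime p ⊗[A] B)),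
        φ x ∈ IsLocalRing.maximalIdeal (Localization.AtPrime q.asIdeal) by
      have := h 1 h1
      rw [map_one] at this
      exact (Ideal.ne_top_iff_one _).mp (IsLocalRing.maximalIdeal.isMaximal _).ne_top this
    intro x hx
    induction hx using Submodule.smul_induction_on' with
    | smul r hr n _ =>
      rw [show r • n = algebraMap _ (Localization.AtPrime p ⊗[A] B) r * n from
        Algebra.smul_def r n, map_mul]
      refine Ideal.mul_mem_right _ _ ?_
      rw [Algebra.TensorProduct.algebraMap_apply, Algebra.TensorProduct.lift_tmul, map_one,
        mul_one, Algebra.algebraMap_self_apply]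
      rw [← Localization.AtPrime.map_eq_maximalIdeal] at hr
      refine (Ideal.map_le_iff_le_comap (K := (IsLocalRing.maximalIdeal _).comap g)).mpr
        (fun a ha => ?_) hr
      rw [Ideal.mem_comap, Ideal.mem_comap, AlgHom.commutes, IsScalarTower.algebraMap_apply A B,
        IsLocalization.AtPrime.to_map_mem_maximal_iff _ q.asIdeal]
      exact hq.ge ha
    | add x _ y _ hx hy =>
      rw [map_add]
      exact add_mem hx hy

/-- A function on a flat cover of an open subset of a spectrum which agrees on the overlaps extends
to the whole spectrum as soon as the local rings outside of the image have depth at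
least two. -/
theorem mem_range_algebraMap_of_tmul_one_eq [IsNoetherianRing A] [Module.Flat A B]
    (hinj : Function.Injective (algebraMap A B))
    (hdepth : ∀ p : PrimeSpectrum A, p ∉ Set.range (PrimeSpectrum.comap (algebraMap A B)) →
      ∃ u ∈ IsLocalRing.maximalIdeal (Localization.AtPrime p.asIdeal),
        ∃ v ∈ IsLocalRing.maximalIdeal (Localization.AtPrime p.asIdeal),
          IsWeaklyRegular (Localization.AtPrime p.asIdeal) [u, v])
    (b : B) (hb : b ⊗ₜ[A] (1 : B) = 1 ⊗ₜ b) : b ∈ Set.range (algebraMap A B) := by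
  let N := LinearMap.range (Algebra.linearMap A B)
  suffices b ∈ N from this
  by_contra hbN
  let x : A ∙ (N.mkQ b) := ⟨N.mkQ b, Submodule.mem_span_singleton_self _⟩
  have hx : x ≠ 0 := fun h => hbN ((Submodule.Quotient.mk_eq_zero N).mp congr(($h).1))
  -- An associated prime of the submodule generated by `b` in `B / A` is the annihilator of the
  -- class of some `a • b`. It suffices to show that this class vanishes after localizing at `p`.
  obtain ⟨p, hp, -⟩ := exists_le_isAssociatedPrime_of_isNoetherianRing A x hx
  obtain ⟨hp, ⟨y, hy⟩, hpy⟩ := isAssociatedPrime_iff.mp hp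
  obtain ⟨a, rfl⟩ := Submodule.mem_span_singleton.mp hy
  have hmem (r : A) : r ∈ p ↔ r • (a • b) ∈ N := by
    rw [hpy, Submodule.mem_colon_singleton, Submodule.mem_bot, ← Submodule.Quotient.mk_eq_zero N,
      Subtype.ext_iff]
    rfl
  suffices h : (1 : Localization.AtPrime p) ⊗ₜ[A] (a • b) ∈ LinearMap.range
      (Algebra.linearMap (Localization.AtPrime p) (Localization.AtPrime p ⊗[A] B)) by
    obtain ⟨s, hs, hsc⟩ := exists_notMem_smul_mem_range_of_localization p h
    exact hs ((hmem s).mpr hsc)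
  by_cases hpU : ⟨p, hp⟩ ∈ Set.range (PrimeSpectrum.comap (algebraMap A B))
  · obtain ⟨q, hq⟩ := hpU
    have := faithfullyFlat_localization_tensorProduct q p congr($(hq).asIdeal)
    refine (Algebra.IsEffective.of_faithfullyFlat (Localization.AtPrime p)
      (Localization.AtPrime p ⊗[A] B) _).mp ?_
    rw [← Algebra.TensorProduct.distribBaseChange_includeLeftSubRight_apply,
      LinearMap.lTensor_tmul, map_smul, Algebra.TensorProduct.includeLeftSubRight_apply, hb]
    simp
  · obtain ⟨u, hu, v, hv, huv⟩ := hdepth ⟨p, hp⟩ hpU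
    have hinj' : Function.Injective
        (algebraMap (Localization.AtPrime p) (Localization.AtPrime p ⊗[A] B)) :=
      Algebra.TensorProduct.includeLeft_injective (S := A) hinj
    let R := LinearMap.range
      (Algebra.linearMap (Localization.AtPrime p) (Localization.AtPrime p ⊗[A] B))
    -- Since `p` kills the class of `a • b`, so does the maximal ideal of the local ring, in
    -- particular `u` and `v`.
    have hmax : IsLocalRing.maximalIdeal (Localization.AtPrime p) ≤
        R.comap (LinearMap.toSpanSingleton _ _ (1 ⊗ₜ[A] (a • b))) := by
      rw [← Localization.AtPrime.map_eq_maximalIdeal]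
      refine Ideal.span_le.mpr ?_
      rintro _ ⟨r, hr, rfl⟩
      obtain ⟨d, hd⟩ := (hmem r).mp hr
      refine ⟨algebraMap _ _ d, ?_⟩
      rw [LinearMap.toSpanSingleton_apply, algebraMap_smul, ← TensorProduct.tmul_smul, ← hd,
        Algebra.linearMap_apply, Algebra.linearMap_apply, Algebra.TensorProduct.algebraMap_apply,
        Algebra.algebraMap_self_apply, Algebra.algebraMap_eq_smul_one, TensorProduct.smul_tmul,
        ← Algebra.algebraMap_eq_smul_one]
    exact huv.mem_range_algebraMap hinj' (hmax hu) (hmax hv)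

end Descent

/-! ### Codimension in terms of specializations -/

section Codimension

variable {X : Type*} [TopologicalSpace X] [QuasiSober X]

theorem exists_specializes_of_two_le_codimension {Z : Set X} (hZ : IsClosed Z)
    (h : 2 ≤ codimension Z) {z : X} (hz : z ∈ Z) :
    ∃ x y : X, x ⤳ y ∧ y ⤳ z ∧ ¬ y ⤳ x ∧ ¬ z ⤳ y := by
  let T : TopologicalSpace.IrreducibleCloseds X :=
    ⟨closure {z}, isIrreducible_singleton.closure, isClosed_closure⟩
  have hT : (T : Set X) ⊆ Z := hZ.closure_subset_iff.mpr (by simpa)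
  have h2 : ((2 : ℕ) : ℕ∞) ≤ Order.coheight T := h.trans (iInf₂_le T hT)
  obtain ⟨l, hl, hlen⟩ := Order.exists_series_of_le_coheight T h2
  have h01 : T < l ⟨1, by omega⟩ :=
    hl ▸ l.strictMono (show (0 : Fin _) < ⟨1, _⟩ by simp [Fin.lt_def])
  have h12 : l ⟨1, by omega⟩ < l ⟨2, by omega⟩ := l.strictMono (by simp)
  obtain ⟨y, hy⟩ := QuasiSober.sober (l ⟨1, by omega⟩).isIrreducible (l ⟨1, by omega⟩).isClosed
  obtain ⟨x, hx⟩ := QuasiSober.sober (l ⟨2, by omega⟩).isIrreducible (l ⟨2, by omega⟩).isClosed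
  rw [← SetLike.coe_ssubset_coe, ← hy.def] at h01
  rw [← SetLike.coe_ssubset_coe, ← hy.def, ← hx.def] at h12
  simp only [specializes_iff_closure_subset]
  exact ⟨x, y, h12.1, h01.1, h12.2, h01.2⟩

/-- An interior point of `Z` would bring the generic point of an irreducible component into `Z`, and
that point has no proper generization. -/
theorem dense_compl_of_two_le_codimension {Z : Set X} (hZ : IsClosed Z)
    (h : 2 ≤ codimension Z) : Dense Zᶜ := by
  rw [← interior_eq_empty_iff_dense_compl, Set.eq_empty_iff_forall_notMem]
  intro x hx
  obtain ⟨η, hη⟩ := QuasiSober.sober (isIrreducible_irreducibleComponent (x := x))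
    isClosed_irreducibleComponent
  have hηx : η ⤳ x := hη.specializes mem_irreducibleComponent
  obtain ⟨-, y, -, hy, -, hy'⟩ := exists_specializes_of_two_le_codimension hZ h
    (interior_subset (hηx.mem_open isOpen_interior hx))
  refine hy' ?_
  rw [specializes_iff_closure_subset, hη.def]
  refine (eq_irreducibleComponent isIrreducible_singleton.closure.isPreirreducible ?_).subset
  rw [← hη.def]
  exact hy.closure_subset

end Codimension

/-! ### Arrows of a pullback groupoid -/

namespace GroupoidObject.Hom

variable {C : Type*} [Category C] [HasPullbacks C] {G H : GroupoidObject C}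

/-- If `G` is the pullback of `H` along `φ`, then objects with the same image are isomorphic,
through the arrow lying over a unit of `H`. -/
theorem exists_arr_of_comp_eq (φ : G.Hom H) [IsIso φ.toPullback] {T : C} (x₁ x₂ : T ⟶ G.obj)
    (h : x₁ ≫ φ.μ = x₂ ≫ φ.μ) : ∃ g : T ⟶ G.arr, g ≫ G.s = x₁ ∧ g ≫ G.t = x₂ := by
  let w : T ⟶ H.pullbackArr φ.μ :=
    pullback.lift (pullback.lift x₁ (x₁ ≫ φ.μ ≫ H.e) (by simp [H.e_s])) x₂
      (by rw [pullback.lift_snd_assoc, Category.assoc, Category.assoc, H.e_t,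
        Category.comp_id, h])
  have hs : φ.toPullback ≫ pullback.fst _ _ ≫ pullback.fst _ _ = G.s := by
    rw [toPullback, pullback.lift_fst_assoc, pullback.lift_fst]
  have ht : φ.toPullback ≫ pullback.snd _ _ = G.t := pullback.lift_snd _ _ _
  refine ⟨w ≫ inv φ.toPullback, ?_, ?_⟩
  · rw [← hs, Category.assoc, IsIso.inv_hom_id_assoc, pullback.lift_fst_assoc, pullback.lift_fst]
  · rw [← ht, Category.assoc, IsIso.inv_hom_id_assoc, pullback.lift_snd]

/-- If `G` is the pullback of `H`, then the arrows of `H` between points in the image of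
the objects of `G` come from arrows of `G`. -/
theorem mem_range_f {S : Scheme.{u}} {G H : GroupoidObject (Over S)} (φ : G.Hom H)
    [IsIso φ.toPullback] {h : H.arr.left} (hs : H.s.left h ∈ Set.range φ.μ.left)
    (ht : H.t.left h ∈ Set.range φ.μ.left) : h ∈ Set.range φ.f.left := by
  obtain ⟨x, hx⟩ := hs
  obtain ⟨x', hx'⟩ := ht
  have sq₁ := (IsPullback.of_hasPullback φ.μ H.s).map (Over.forget S)
  have sq₂ := (IsPullback.of_hasPullback (pullback.snd φ.μ H.s ≫ H.t) φ.μ).map (Over.forget S)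
  -- Points of a fibre product surject onto compatible pairs of points; this is applied once for the
  -- source and once for the target.
  obtain ⟨z, -, hz⟩ := Scheme.exists_preimage_of_isPullback sq₁ x h hx
  obtain ⟨w, hw, -⟩ := Scheme.exists_preimage_of_isPullback sq₂ z x' (by
    have := (hx'.trans congr(H.t.left $hz.symm)).symm
    exact this)
  have hf : φ.f = φ.toPullback ≫ pullback.fst _ _ ≫ pullback.snd _ _ := by
    rw [toPullback, pullback.lift_fst_assoc, pullback.lift_snd]
  refine ⟨(inv φ.toPullback).left w, ?_⟩
  have hinv : inv φ.toPullback ≫ φ.f = pullback.fst _ _ ≫ pullback.snd _ _ := by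
    rw [hf, IsIso.inv_hom_id_assoc]
  have hw' := congr(($hinv).left w)
  rw [Over.comp_left, Over.comp_left] at hw'
  exact hw'.trans ((congr((pullback.snd φ.μ H.s).left $hw)).trans hz)

end GroupoidObject.Hom

/-! ### Functions and points of affine schemes -/

namespace AlgebraicGeometry

/-- Functions on a reduced scheme are determined by their pullback along a dominant morphism. -/
theorem Scheme.Hom.appTop_injective_of_denseRange {X Y : Scheme.{u}} (f : X ⟶ Y) [IsReduced Y]
    [QuasiCompact f] (hf : DenseRange f) : Function.Injective f.appTop := by
  have : IsDominant f := ⟨hf⟩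
  have := IsSchemeTheoreticallyDominant.of_isDominant f
  exact f.app_injective ⊤

theorem exists_appTop_comp_ΓSpecIso {X : Scheme.{u}} [IsAffine X] {R : CommRingCat.{u}}
    (φ : Γ(X, ⊤) ⟶ R) : ∃ j : Spec R ⟶ X, j.appTop ≫ (Scheme.ΓSpecIso R).hom = φ := by
  refine ⟨Spec.map φ ≫ X.isoSpec.inv, ?_⟩
  rw [Scheme.Hom.comp_appTop, Category.assoc, Scheme.ΓSpecIso_naturality,
    ← Scheme.toSpecΓ_appTop, ← Category.assoc, ← Scheme.Hom.comp_appTop,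
    Scheme.toSpecΓ_isoSpec_inv, Scheme.Hom.id_appTop, Category.id_comp]

theorem mem_range_comap_appTop {X Y : Scheme.{u}} [IsAffine X] [IsAffine Y] (f : X ⟶ Y) (x : X) :
    Y.isoSpec.hom (f x) ∈ Set.range (PrimeSpectrum.comap f.appTop.hom) := by
  refine ⟨X.isoSpec.hom x, ?_⟩
  have := congr($(Scheme.isoSpec_hom_naturality f) x)
  exact this

end AlgebraicGeometry

/-! ### Invariant functions under a Hartogs Morita morphism -/

namespace IsHartogsMorita

open TensorProduct RingTheory.Sequence

variable {G H : GroupoidObject ComplexScheme} {φ : G.Hom H}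

theorem isOpen_range (hφ : IsHartogsMorita φ) : IsOpen (Set.range φ.μ.left) := by
  have := hφ.smooth
  exact φ.μ.left.isOpenMap.isOpen_range

theorem dense_range (hφ : IsHartogsMorita φ) : DenseRange φ.μ.left := by
  have h := dense_compl_of_two_le_codimension hφ.isOpen_range.isClosed_compl
    hφ.two_le_codimension
  rwa [compl_compl] at h

/-- Arrows of `H` with both ends in the dense open image of `μ` form a dense set, as `s` and `t` are
open maps, and all of them come from `G`. -/
theorem dense_range_f (hφ : IsHartogsMorita φ) (hs : Smooth H.s.left) (ht : Smooth H.t.left) :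
    DenseRange φ.f.left := by
  have := hφ.isIso_toPullback
  refine ((hφ.dense_range.preimage H.s.left.isOpenMap).inter_of_isOpen_left
    (hφ.dense_range.preimage H.t.left.isOpenMap)
    (hφ.isOpen_range.preimage H.s.left.continuous)).mono ?_
  exact fun h hh => φ.mem_range_f hh.1 hh.2

/-- Functions on the objects of `G` invariant under `G` agree on the overlaps of the cover given
by `μ`. -/
theorem tmul_one_eq_of_invariant (hφ : IsHartogsMorita φ) [IsAffine G.obj.left]
    [IsAffine H.obj.left] [Algebra Γ(H.obj.left, ⊤) Γ(G.obj.left, ⊤)]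
    (halg : algebraMap Γ(H.obj.left, ⊤) Γ(G.obj.left, ⊤) = φ.μ.left.appTop.hom)
    (b : Γ(G.obj.left, ⊤)) (hb : G.s.left.appTop b = G.t.left.appTop b) :
    b ⊗ₜ[Γ(H.obj.left, ⊤)] (1 : Γ(G.obj.left, ⊤)) = 1 ⊗ₜ b := by
  let A := Γ(H.obj.left, ⊤)
  let B := Γ(G.obj.left, ⊤)
  have := hφ.isIso_toPullback
  let R : CommRingCat := CommRingCat.of (B ⊗[A] B)
  obtain ⟨j₁, hj₁⟩ := exists_appTop_comp_ΓSpecIso (X := G.obj.left) (R := R)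
    (CommRingCat.ofHom Algebra.TensorProduct.includeLeftRingHom)
  obtain ⟨j₂, hj₂⟩ := exists_appTop_comp_ΓSpecIso (X := G.obj.left) (R := R)
    (CommRingCat.ofHom (Algebra.TensorProduct.includeRight (R := A)).toRingHom)
  have hj : j₁ ≫ φ.μ.left = j₂ ≫ φ.μ.left := by
    apply ext_of_isAffine
    rw [← cancel_mono (Scheme.ΓSpecIso R).hom, Scheme.Hom.comp_appTop, Scheme.Hom.comp_appTop,
      Category.assoc, Category.assoc, hj₁, hj₂]
    ext a
    change (φ.μ.left.appTop.hom a) ⊗ₜ[A] (1 : B) = (1 : B) ⊗ₜ[A] (φ.μ.left.appTop.hom a)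
    rw [← halg, Algebra.algebraMap_eq_smul_one, smul_tmul]
  -- `T` is `X ×_Y X`, written as the spectrum of `B ⊗[A] B`, with projections `x₁` and `x₂`.
  let T : ComplexScheme := Over.mk (j₁ ≫ G.obj.hom)
  let x₁ : T ⟶ G.obj := Over.homMk j₁
  let x₂ : T ⟶ G.obj := Over.homMk j₂ (by
    change j₂ ≫ G.obj.hom = j₁ ≫ G.obj.hom
    rw [← Over.w φ.μ, ← Category.assoc, ← Category.assoc, hj])
  obtain ⟨g, hgs, hgt⟩ := φ.exists_arr_of_comp_eq x₁ x₂ (Over.OverMorphism.ext hj)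
  have hgs' : j₁ = g.left ≫ G.s.left := congr(($hgs).left).symm
  have hgt' : j₂ = g.left ≫ G.t.left := congr(($hgt).left).symm
  have h₁ : (Scheme.ΓSpecIso R).hom (j₁.appTop b) = b ⊗ₜ[A] (1 : B) := congr($hj₁ b)
  have h₂ : (Scheme.ΓSpecIso R).hom (j₂.appTop b) = (1 : B) ⊗ₜ[A] b := congr($hj₂ b)
  rw [← h₁, ← h₂, hgs', hgt', Scheme.Hom.comp_appTop, Scheme.Hom.comp_appTop]
  exact congr((Scheme.ΓSpecIso R).hom (g.left.appTop $hb))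

/-- Invariant functions on the objects of `G` come from functions on the objects of `H`. -/
theorem exists_appTop_eq (hφ : IsHartogsMorita φ) (hX : IsAffine G.obj.left)
    (hY : IsAffine H.obj.left) (hred : IsReduced H.obj.left) (hsm : Smooth H.obj.hom)
    (b : Γ(G.obj.left, ⊤)) (hb : G.s.left.appTop b = G.t.left.appTop b) :
    ∃ a, φ.μ.left.appTop a = b := by
  have hsmA : ((Scheme.ΓSpecIso (CommRingCat.of ℂ)).inv ≫ H.obj.hom.appTop).hom.Smooth := by
    have h : H.obj.hom.appTop.hom.Smooth := HasRingHomProperty.iff_of_isAffine.mp hsm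
    exact RingHom.Smooth.respectsIso.2 _
      (Scheme.ΓSpecIso (CommRingCat.of ℂ)).symm.commRingCatIsoToRingEquiv h
  have hflat : φ.μ.left.appTop.hom.Flat := by
    have := hφ.smooth
    exact HasRingHomProperty.iff_of_isAffine.mp (inferInstance : Flat φ.μ.left)
  let : Algebra ℂ Γ(H.obj.left, ⊤) := RingHom.toAlgebra
    ((Scheme.ΓSpecIso (CommRingCat.of ℂ)).inv ≫ H.obj.hom.appTop).hom
  have : Algebra.Smooth ℂ Γ(H.obj.left, ⊤) := hsmA
  have : IsNoetherianRing Γ(H.obj.left, ⊤) := Algebra.FiniteType.isNoetherianRing ℂ _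
  let : Algebra Γ(H.obj.left, ⊤) Γ(G.obj.left, ⊤) := φ.μ.left.appTop.hom.toAlgebra
  have : Module.Flat Γ(H.obj.left, ⊤) Γ(G.obj.left, ⊤) := hflat
  refine mem_range_algebraMap_of_tmul_one_eq
    (φ.μ.left.appTop_injective_of_denseRange hφ.dense_range) (fun p hp => ?_) b
    (hφ.tmul_one_eq_of_invariant rfl b hb)
  let e : H.obj.left ≃ₜ PrimeSpectrum Γ(H.obj.left, ⊤) := Scheme.homeoOfIso H.obj.left.isoSpec
  have hz : e.symm p ∈ (Set.range φ.μ.left)ᶜ := by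
    rintro ⟨x, hx⟩
    refine hp ?_
    have := mem_range_comap_appTop φ.μ.left x
    rw [hx] at this
    rwa [show H.obj.left.isoSpec.hom (e.symm p) = p from e.apply_symm_apply p] at this
  obtain ⟨x, y, hxy, hyz, hyx, hzy⟩ := exists_specializes_of_two_le_codimension
    hφ.isOpen_range.isClosed_compl hφ.two_le_codimension hz
  have hs (x y : H.obj.left) : x ⤳ y ↔ e x ≤ e y := by
    rw [← e.isInducing.specializes_iff, PrimeSpectrum.le_iff_specializes]
  rw [hs] at hxy hyx hyz hzy
  rw [e.apply_symm_apply] at hyz hzy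
  have h₀ := lt_of_le_not_ge hxy hyx
  have h₁ := lt_of_le_not_ge hyz hzy
  exact Algebra.Smooth.exists_isWeaklyRegular_pair (K := ℂ) h₀ h₁

theorem bijective_invariantFunctionsMap (hφ : IsHartogsMorita φ)
    (hG : IsAffineAlgebraicLieGroupoid G) (hH : IsAffineAlgebraicLieGroupoid H) :
    Function.Bijective (invariantFunctionsMap φ) := by
  have := hG.obj_affine
  have := hG.arr_affine
  have := hH.obj_affine
  have := hH.arr_affine
  have := hH.obj_variety.isReduced
  have := hH.arr_variety.isReduced
  constructor
  · intro a a' h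
    exact Subtype.ext (φ.μ.left.appTop_injective_of_denseRange hφ.dense_range congr(($h).1))
  · rintro ⟨b, hb⟩
    obtain ⟨a, ha⟩ : ∃ a : CoordRing H.obj, CoordRing.map φ.μ a = b :=
      hφ.exists_appTop_eq hG.obj_affine hH.obj_affine hH.obj_variety.isReduced hH.obj_smooth b hb
    refine ⟨⟨a, ?_⟩, Subtype.ext ha⟩
    change CoordRing.map H.s a = CoordRing.map H.t a
    refine φ.f.left.appTop_injective_of_denseRange
      (hφ.dense_range_f hH.s_smooth hH.t_smooth) ?_
    change CoordRing.map φ.f (CoordRing.map H.s a) = CoordRing.map φ.f (CoordRing.map H.t a)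
    rw [← CoordRing.map_comp_apply, ← CoordRing.map_comp_apply, φ.f_s, φ.f_t,
      CoordRing.map_comp_apply, CoordRing.map_comp_apply, ha]
    exact hb

end IsHartogsMorita

theorem mainTheorem8 (G H : GroupoidObject ComplexScheme)
    (hG : IsAffineAlgebraicLieGroupoid G) (hH : IsAffineAlgebraicLieGroupoid H)
    (φ : G.Hom H) (hφ : IsHartogsMorita φ) :
    IsIso (affineQuotientMap φ) := by
  have h : IsIso (CommRingCat.ofHom (invariantFunctionsMap φ).toRingHom) :=
    (ConcreteCategory.isIso_iff_bijective _).mpr (hφ.bijective_invariantFunctionsMap hG hH)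
  have : IsIso ((Over.forget _).map (affineQuotientMap φ)) :=
    inferInstanceAs (IsIso (Spec.map (CommRingCat.ofHom (invariantFunctionsMap φ).toRingHom)))
  exact isIso_of_reflects_iso (affineQuotientMap φ) (Over.forget _)
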